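/- \textbf{Task model.} A dynamic mixed-criticality (MC) task system $\tau$ consists of finitely many sporadic tasks $\tau_i$ with minimum separation and relative deadline $T_i>0$, execution bound $C_i>0$, and a criticality LC or HC; each LC task also has a fraction $\alpha_i\in[0,1]$. A job sequence assigns release times and execution demands (at most $C_i$ for a job of $\tau_i$) to jobs, distinct jobs of $\tau_i$ being released at least $T_i$ apart; the deadline of a job is its release time plus $T_i$. Put $u_i=C_i/T_i$, $U_H=\sum_{\tau_i\in\mathrm{HC}}u_i$, $U_L=\sum_{\tau_i\in\mathrm{LC}}u_i$ and $\alpha^*=\big(\sum_{\tau_i\in\mathrm{LC}}\alpha_iu_i\big)/U_L$. Let $\beta^*\in[0,1]$ (so $\beta^*U_H$ is the share reserved for all HC tasks together in the LC mode) and let $x\in[0,1]$ be the virtual-deadline factor. \textbf{EDF-UVD.} On a preemptive uniprocessor, the highest-priority pending job is executed at each time; priority goes to the earliest deadline, ties being broken arbitrarily. In the LC mode, a job of an LC task that has executed for at least $\alpha_iC_i$ is scheduled by its original deadline; every other job of $\tau_i$ is scheduled by its virtual deadline, $xT_i$ after its release. In the HC mode all jobs are scheduled by their original deadlines, and a job of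 an LC task that has executed for $\alpha_iC_i$ or more receives no further execution (it is cut off for good). A job is pending if it is released, incomplete and not cut off. An idle instant is a time $t$ at which no job released before $t$ is pending; idle instants delimit the busy intervals. \textbf{MEBA.} For an HC task $\tau_j$ let $e_j^m$ be the largest amount for which any of its jobs has executed so far in the current busy interval. In the LC mode a job of an HC task $\tau_i$ allocated to the processor has budget $b_i=T_i\big(\beta^*U_H-\sum_{\tau_j\in\mathrm{HC},\,j\ne i}e_j^m/T_j\big)$. If it has executed for $b_i$ in total and is incomplete, the system switches to the HC mode, and stays there until the next idle instant, when it returns to the LC mode and all $e_j^m$ are reset to $0$. \textbf{MC-schedulability.} $\tau$ is MC-schedulable by MEBA and EDF-UVD if in every such schedule of every job sequence: every job of an HC task receives its whole demand by its deadline; every job of an LC task receives its whole demand by its deadline if the system is in the LC mode from its release up to its deadline, and otherwise receives by its deadline at least the minimum of its demand and $\alpha_iC_i$. \textbf{Theorem.} Suppose $U_H>0$, $U_L>0$, $\alpha^*<1$ and $U_L(1-\alpha^*)<1$. If $$(1-\alpha^*)(1-\beta^*)\ \ge\ \frac{U_H+U_L-1}{U_L\,U_H}$$ and $$x\in\left[\frac{\beta^*U_H+\alpha^*U_L}{1-U_L(1-\alpha^*)},\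 \frac{1-U_H-\alpha^*U_L}{(1-\alpha^*)U_L}\right],$$ then $\tau$ is MC-schedulable by MEBA and EDF-UVD on a uniprocessor. -/

import Mathlib

/-- The two criticality levels of a task: low (`LC`) and high (`HC`). -/
inductive Criticality where
  | LC
  | HC
  deriving DecidableEq

/-- A dynamic mixed-criticality system of implicit-deadline sporadic tasks, indexed by `ι`:
minimum separation (and relative deadline) `T i`, execution bound `C i`, criticality `crit i`, and,
for the LC tasks, the fraction `α i` of `C i` that is guaranteed in the HC mode. -/
structure MCTaskSystem (ι : Type*) where
  T : ι → ℝ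
  C : ι → ℝ
  crit : ι → Criticality
  α : ι → ℝ
  T_pos : ∀ i, 0 < T i
  C_pos : ∀ i, 0 < C i
  α_nonneg : ∀ i, crit i = Criticality.LC → 0 ≤ α i
  α_le_one : ∀ i, crit i = Criticality.LC → α i ≤ 1

namespace MCTaskSystem

/-- Utilization of the HC tasks. -/
noncomputable def UH {ι : Type*} [Fintype ι] (τ : MCTaskSystem ι) : ℝ :=
  ∑ i with τ.crit i = Criticality.HC, τ.C i / τ.T i

/-- Utilization of the LC tasks. -/
noncomputable def UL {ι : Type*} [Fintype ι] (τ : MCTaskSystem ι) : ℝ :=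
  ∑ i with τ.crit i = Criticality.LC, τ.C i / τ.T i

/-- The HC system service level `α*`. -/
noncomputable def alphaStar {ι : Type*} [Fintype ι] (τ : MCTaskSystem ι) : ℝ :=
  (∑ i with τ.crit i = Criticality.LC, τ.α i * (τ.C i / τ.T i)) / τ.UL

end MCTaskSystem

/-- A job sequence that the task system can generate: each job has a task, a release time and an
execution demand (unknown to the scheduler until the job completes); releases of distinct jobs of
one task are at least `T` apart. -/
structure JobSequence {ι : Type*} (τ : MCTaskSystem ι) (J : Type) where
  task : J → ι
  release : J → ℝ
  demand : J → ℝ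
  release_nonneg : ∀ j, 0 ≤ release j
  separation : ∀ j k, j ≠ k → task j = task k → τ.T (task j) ≤ |release j - release k|
  demand_nonneg : ∀ j, 0 ≤ demand j
  demand_le : ∀ j, demand j ≤ τ.C (task j)

namespace JobSequence

/-- The original absolute deadline. -/
def deadline {ι : Type*} {τ : MCTaskSystem ι} {J : Type} (S : JobSequence τ J) (j : J) : ℝ :=
  S.release j + τ.T (S.task j)

/-- The virtual absolute deadline, for the virtual deadline factor `x`. -/
def virtualDeadline {ι : Type*} {τ : MCTaskSystem ι} {J : Type} (S : JobSequence τ J) (x : ℝ)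
    (j : J) : ℝ :=
  S.release j + x * τ.T (S.task j)

/-- `j` is a job of a HC task. -/
def IsHC {ι : Type*} {τ : MCTaskSystem ι} {J : Type} (S : JobSequence τ J) (j : J) : Prop :=
  τ.crit (S.task j) = Criticality.HC

/-- `j` is a job of a LC task. -/
def IsLC {ι : Type*} {τ : MCTaskSystem ι} {J : Type} (S : JobSequence τ J) (j : J) : Prop :=
  τ.crit (S.task j) = Criticality.LC

/-- The budget `α i * C i` of a job of a LC task in the HC mode. -/
def hcBudget {ι : Type*} {τ : MCTaskSystem ι} {J : Type} (S : JobSequence τ J) (j : J) : ℝ :=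
  τ.α (S.task j) * τ.C (S.task j)

end JobSequence

/-- A timed record of a preemptive uniprocessor. `run t` is the job that executes at time `t`,
`hc` is the set of times at which the system is in the HC mode, and `pick t` is the job that the
LC-mode dispatcher selects at `t` (it executes at `t` unless the system is, or thereupon switches
to, the HC mode). -/
structure Schedule (J : Type) where
  run : ℝ → Option J
  pick : ℝ → Option J
  hc : Set ℝ

/-- `c` is an earliest-deadline-first choice among the jobs in `elig`, with absolute deadlines
`key`; ties are broken arbitrarily, and no job is chosen only if none is eligible. -/
def IsEDFChoice {J : Type} (elig : J → Prop) (key : J → ℝ) : Option J → Prop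
  | none => ∀ j, ¬ elig j
  | some j => elig j ∧ ∀ k, elig k → key j ≤ key k

namespace Schedule

/-- The amount of execution that job `j` has received before time `t`. -/
noncomputable def exec {ι : Type*} {τ : MCTaskSystem ι} {J : Type} (σ : Schedule J)
    (S : JobSequence τ J) (j : J) (t : ℝ) : ℝ :=
  MeasureTheory.volume.real ({s | σ.run s = some j} ∩ Set.Ico (S.release j) t)

/-- A job of a LC task is cut off by time `t` if, at the end `u ≤ t` of some HC-mode period
`[s, u)` after its release, it has used up its HC-mode budget. -/
def CutOff {ι : Type*} {τ : MCTaskSystem ι} {J : Type} (σ : Schedule J)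
    (S : JobSequence τ J) (j : J) (t : ℝ) : Prop :=
  S.IsLC j ∧ ∃ s u, S.release j ≤ s ∧ s < u ∧ u ≤ t ∧ Set.Ico s u ⊆ σ.hc ∧
    S.hcBudget j ≤ σ.exec S j u

/-- `j` is released, has not completed, and has not been cut off. -/
def Pending {ι : Type*} {τ : MCTaskSystem ι} {J : Type} (σ : Schedule J)
    (S : JobSequence τ J) (j : J) (t : ℝ) : Prop :=
  S.release j ≤ t ∧ σ.exec S j t < S.demand j ∧ ¬ σ.CutOff S j t

/-- `t` is an idle instant: no job released before `t` is still pending. -/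
def IdleInstant {ι : Type*} {τ : MCTaskSystem ι} {J : Type} (σ : Schedule J)
    (S : JobSequence τ J) (t : ℝ) : Prop :=
  ∀ j, S.release j < t → ¬ σ.Pending S j t

/-- `j` was released in the busy interval that contains `t`, at `t` or before: no idle instant
separates its release from `t`. -/
def InBusyInterval {ι : Type*} {τ : MCTaskSystem ι} {J : Type} (σ : Schedule J)
    (S : JobSequence τ J) (j : J) (t : ℝ) : Prop :=
  S.release j ≤ t ∧ ∀ u, S.release j < u → u ≤ t → ¬ σ.IdleInstant S u

/-- `e_i^m` at time `t`: the largest amount for which any job of task `i` has executed so far in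
the current busy interval (`0` if there is none). -/
noncomputable def maxExec {ι : Type*} {τ : MCTaskSystem ι} {J : Type} (σ : Schedule J)
    (S : JobSequence τ J) (i : ι) (t : ℝ) : ℝ :=
  sSup ((fun j => σ.exec S j t) '' {j | S.task j = i ∧ σ.InBusyInterval S j t})

open scoped Classical in
/-- The budget `b_i` that MEBA allocates at time `t` to a job of the HC task `i`, when a total of
`β * U_H` is reserved for the HC tasks. While a job of task `i` executes, the other tasks do not, so
this value stays what it was when the job was allocated to the processor. -/
noncomputable def budget {ι : Type*} [Fintype ι] {τ : MCTaskSystem ι} {J : Type} (σ : Schedule J)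
    (S : JobSequence τ J) (β : ℝ) (i : ι) (t : ℝ) : ℝ :=
  τ.T i * (β * τ.UH -
    ∑ k with τ.crit k = Criticality.HC ∧ k ≠ i, σ.maxExec S k t / τ.T k)

/-- MEBA triggers a switch to the HC mode at `t`: an incomplete job of a HC task, which is selected
for execution at `t` or was executing up to `t`, has executed for its whole budget. -/
def Trigger {ι : Type*} [Fintype ι] {τ : MCTaskSystem ι} {J : Type} (σ : Schedule J)
    (S : JobSequence τ J) (β : ℝ) (t : ℝ) : Prop :=
  ∃ j, S.IsHC j ∧ σ.Pending S j t ∧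
    (σ.pick t = some j ∨ ∃ u < t, ∀ s ∈ Set.Ico u t, σ.run s = some j) ∧
    σ.budget S β (S.task j) t ≤ σ.exec S j t

open scoped Classical in
/-- The deadline by which EDF-UVD schedules job `j` at time `t` in the LC mode. -/
noncomputable def lcKey {ι : Type*} {τ : MCTaskSystem ι} {J : Type} (σ : Schedule J)
    (S : JobSequence τ J) (x : ℝ) (t : ℝ) (j : J) : ℝ :=
  if S.IsLC j ∧ S.hcBudget j ≤ σ.exec S j t then S.deadline j else S.virtualDeadline x j

/-- `σ` is a schedule of the job sequence `S` under MEBA (with LC system service level `β`)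
together with EDF-UVD (with virtual deadline factor `x`). -/
structure IsMEBAEDFUVD {ι : Type*} [Fintype ι] {τ : MCTaskSystem ι} {J : Type} (σ : Schedule J)
    (S : JobSequence τ J) (β x : ℝ) : Prop where
  measurable : ∀ j, MeasurableSet {t | σ.run t = some j}
  /-- The LC-mode dispatcher is EDF with respect to the LC-mode deadlines. -/
  pick_edf : ∀ t, IsEDFChoice (fun j => σ.Pending S j t) (σ.lcKey S x t) (σ.pick t)
  run_lc : ∀ t, t ∉ σ.hc → σ.run t = σ.pick t
  /-- In the HC mode, EDF with respect to the original deadlines is used, and jobs of LC tasks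
  are limited to their HC-mode budgets. -/
  run_hc : ∀ t, t ∈ σ.hc → IsEDFChoice
    (fun j => σ.Pending S j t ∧ (S.IsLC j → σ.exec S j t < S.hcBudget j)) S.deadline (σ.run t)
  /-- The system is in the HC mode from a triggered mode-switch until the next idle instant. -/
  mode : ∀ t, t ∈ σ.hc ↔
    ∃ s ≤ t, σ.Trigger S β s ∧ ∀ u, s < u → u ≤ t → ¬ σ.IdleInstant S u

end Schedule

/-- The system `τ` is MC-schedulable by MEBA and EDF-UVD: in every schedule of every job sequence,
each job of a HC task receives its whole demand by its deadline, each job of a LC task receives its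
whole demand by its deadline if the system stays in the LC mode from its release up to its deadline,
and at least its demand up to `α i * C i` otherwise. -/
def MCSchedulable {ι : Type*} [Fintype ι] (τ : MCTaskSystem ι) (β x : ℝ) : Prop :=
  ∀ (J : Type) (S : JobSequence τ J) (σ : Schedule J), σ.IsMEBAEDFUVD S β x → ∀ j : J,
    (S.IsHC j → S.demand j ≤ σ.exec S j (S.deadline j)) ∧
    (S.IsLC j → (∀ t ∈ Set.Ico (S.release j) (S.deadline j), t ∉ σ.hc) →
      S.demand j ≤ σ.exec S j (S.deadline j)) ∧
    (S.IsLC j → (∃ t ∈ Set.Ico (S.release j) (S.deadline j), t ∈ σ.hc) →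
      min (S.demand j) (S.hcBudget j) ≤ σ.exec S j (S.deadline j))

/-! A processor-demand argument by contradiction. Suppose a job misses its guarantee at its deadline
`d`. Since the last idle instant `p` there is at most one mode switch, at some `s` in `[p, d]`.

Until `s`, MEBA keeps the HC executions within the reserve: with `e i` the largest execution of a
job of task `i`, the sum of `e i / T i` over the HC tasks is at most `β * U_H` (`sum_exec_div_le`,
`exists_exec_le`).

If work with original deadline at most `d` is owed at `s` without a gap up to `d`, let `a` be the
earliest release among the jobs owed such work at `s`, and put `v = a + x * (d - a)`. While one of
these jobs waits, the LC mode runs only work with key at most `v`; let `t₀ ≤ a` be the last time up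
to `a` at which no such work is pending. The processor is busy on `[t₀, d)`, almost everywhere, with
jobs released since `t₀`: before `s` with work of key at most `v`, after `s` with HC-mode work due
by `d`, whose jobs are all released from `a` on.

Counting per task (`card_mul_add_card_mul_le`, `sum_jobBound_le`), this work is at most `(a - t₀) *
R₁ + (d - a) * R₂`, where `R₁ = (∑ e i / T i + α* U_L) / x + (1 - α*) U_L`, with the sum over the HC
tasks, and `R₂ = U_H + α* U_L + x * (1 - α*) U_L`. The lower end of the range of `x` gives `R₁ ≤ 1`,
the upper end `R₂ ≤ 1`. The missing job leaves the executed work strictly below the bound, hence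
below `d - t₀`: a contradiction.

The remaining cases are degenerate: only HC-mode work (`a = t₀`), or only LC-mode work (`a = d`). -/

section

open MeasureTheory Set

/-! ### Counting the jobs of a task, and their demand in each mode -/

namespace JobSequence

variable {ι : Type*} {τ : MCTaskSystem ι} {J : Type} (S : JobSequence τ J)

theorem isHC_iff_not_isLC (j : J) : S.IsHC j ↔ ¬ S.IsLC j := by
  unfold IsHC IsLC
  cases τ.crit (S.task j) <;> simp

theorem release_lt_deadline (j : J) : S.release j < S.deadline j := by
  have := τ.T_pos (S.task j)
  unfold deadline
  linarith

theorem virtualDeadline_le_deadline {x : ℝ} (hx : x ≤ 1) (j : J) :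
    S.virtualDeadline x j ≤ S.deadline j := by
  have := τ.T_pos (S.task j)
  unfold deadline virtualDeadline
  nlinarith

theorem hcBudget_nonneg {j : J} (h : S.IsLC j) : 0 ≤ S.hcBudget j :=
  mul_nonneg (τ.α_nonneg _ h) (τ.C_pos _).le

/-- Jobs of one task with releases in `[lo, hi]` are at most `(hi - lo) / T + 1` in number. -/
theorem card_sub_one_mul_le {i : ι} {K : Finset J} (hK : ∀ j ∈ K, S.task j = i) {lo hi : ℝ}
    (hle : lo ≤ hi) (hlo : ∀ j ∈ K, lo ≤ S.release j) (hhi : ∀ j ∈ K, S.release j ≤ hi) :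
    ((K.card : ℝ) - 1) * τ.T i ≤ hi - lo := by
  have hT := τ.T_pos i
  have hcard : K.card ≤ (Finset.range (⌊(hi - lo) / τ.T i⌋₊ + 1)).card := by
    -- By separation, each slot of length `T i` counted from `lo` contains at most one release.
    refine Finset.card_le_card_of_injOn (fun j => ⌊(S.release j - lo) / τ.T i⌋₊) ?_ ?_
    · intro j hj
      have h1 := hhi j hj
      simp only [Finset.coe_range, mem_Iio, Nat.lt_succ_iff]
      exact Nat.floor_le_floor (by gcongr)
    · intro j hj k hk hjk
      by_contra hne
      have hsep := S.separation j k hne ((hK j hj).trans (hK k hk).symm)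
      rw [hK j hj] at hsep
      have h0 : 0 ≤ (S.release j - lo) / τ.T i := div_nonneg (by linarith [hlo j hj]) hT.le
      have h1 : 0 ≤ (S.release k - lo) / τ.T i := div_nonneg (by linarith [hlo k hk]) hT.le
      have hjk' : ⌊(S.release j - lo) / τ.T i⌋₊ = ⌊(S.release k - lo) / τ.T i⌋₊ := hjk
      have a1 := Nat.floor_le h0
      have a2 := Nat.lt_floor_add_one ((S.release j - lo) / τ.T i)
      have b1 := Nat.floor_le h1
      have b2 := Nat.lt_floor_add_one ((S.release k - lo) / τ.T i)
      rw [hjk'] at a1 a2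
      have hd : |(S.release j - lo) / τ.T i - (S.release k - lo) / τ.T i| < 1 := by
        rw [abs_lt]; constructor <;> linarith
      rw [← sub_div, abs_div, abs_of_pos hT, div_lt_one hT] at hd
      have : S.release j - lo - (S.release k - lo) = S.release j - S.release k := by ring
      rw [this] at hd
      linarith
  rw [Finset.card_range] at hcard
  have h0 : 0 ≤ (hi - lo) / τ.T i := div_nonneg (by linarith) hT.le
  have h1 := Nat.floor_le h0
  have h2 : (K.card : ℝ) ≤ ⌊(hi - lo) / τ.T i⌋₊ + 1 := by exact_mod_cast hcard
  rw [← le_div_iff₀ hT]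
  linarith

theorem card_mul_le {i : ι} {K : Finset J} (hK : ∀ j ∈ K, S.task j = i) {lo hi : ℝ}
    (hle : lo ≤ hi) (hlo : ∀ j ∈ K, lo ≤ S.release j) (hhi : ∀ j ∈ K, S.deadline j ≤ hi) :
    (K.card : ℝ) * τ.T i ≤ hi - lo := by
  rcases K.eq_empty_or_nonempty with rfl | ⟨j, hj⟩
  · simpa using hle
  · have hd : ∀ k ∈ K, S.release k ≤ hi - τ.T i := by
      intro k hk
      have := hhi k hk
      rw [deadline, hK k hk] at this
      linarith
    have := S.card_sub_one_mul_le hK ((hlo j hj).trans (hd j hj)) hlo hd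
    linarith

/-- Contribution of one task to the demand over `[t₀, d)`, when the jobs `K₁` released before `a`
count for `e` each, and the jobs `K₂` released from `a` on count for `c` each. -/
theorem card_mul_add_card_mul_le {i : ι} {K₁ K₂ : Finset J} (h₁ : ∀ j ∈ K₁, S.task j = i)
    (h₂ : ∀ j ∈ K₂, S.task j = i) {x t₀ a d e c : ℝ} (hx0 : 0 ≤ x) (hx1 : x ≤ 1)
    (hta : t₀ ≤ a) (had : a ≤ d) (he : 0 ≤ e) (hec : e ≤ c) (hxe : x = 0 → e = 0)
    (hlo₁ : ∀ j ∈ K₁, t₀ ≤ S.release j) (hhi₁ : ∀ j ∈ K₁, S.release j < a)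
    (hv₁ : ∀ j ∈ K₁, S.virtualDeadline x j ≤ a + x * (d - a))
    (hlo₂ : ∀ j ∈ K₂, a ≤ S.release j) (hhi₂ : ∀ j ∈ K₂, S.deadline j ≤ d) :
    K₁.card * e + K₂.card * c ≤ (a - t₀) * (e / τ.T i / x) + (d - a) * (c / τ.T i) := by
  have hT := τ.T_pos i
  have hc : 0 ≤ c := he.trans hec
  have hm : (K₂.card : ℝ) * τ.T i ≤ d - a := S.card_mul_le h₂ had hlo₂ hhi₂
  -- At `x = 0` division by `x` returns `0`, so the bound survives only because `hxe` makes `e`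
  -- vanish.
  rcases hx0.eq_or_lt with rfl | hxpos
  · rw [hxe rfl]
    have : (K₂.card : ℝ) * c ≤ (d - a) * (c / τ.T i) := by
      calc (K₂.card : ℝ) * c = (K₂.card * τ.T i) * (c / τ.T i) := by field_simp
        _ ≤ _ := by gcongr
    simpa using this
  have hdiv : e / τ.T i ≤ e / τ.T i / x := le_div_self (by positivity) hxpos hx1
  rcases K₂.eq_empty_or_nonempty with rfl | hne
  · rcases K₁.eq_empty_or_nonempty with rfl | ⟨j, hj⟩
    · simp only [Finset.card_empty, Nat.cast_zero, zero_mul, add_zero]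
      have : 0 ≤ a - t₀ := by linarith
      have : 0 ≤ d - a := by linarith
      positivity
    have hr : ∀ k ∈ K₁, S.release k ≤ a + x * (d - a) - x * τ.T i := by
      intro k hk
      have := hv₁ k hk
      rw [virtualDeadline, h₁ k hk] at this
      linarith
    have hk := S.card_sub_one_mul_le h₁ ((hlo₁ j hj).trans (hr j hj)) hlo₁ hr
    have hk1 : (1 : ℝ) ≤ K₁.card := by
      exact_mod_cast Finset.card_pos.mpr ⟨j, hj⟩
    -- The last job needs only `x * T` before `v`; the other `K₁.card - 1` gaps of length `T` are
    -- shrunk to `x * T`.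
    have hkx : (K₁.card : ℝ) * (x * τ.T i) ≤ (a - t₀) + x * (d - a) := by
      have : 0 ≤ ((K₁.card : ℝ) - 1) * τ.T i * (1 - x) :=
        mul_nonneg (mul_nonneg (by linarith) hT.le) (by linarith)
      nlinarith
    have hda : 0 ≤ d - a := by linarith
    calc (K₁.card : ℝ) * e + (∅ : Finset J).card * c
        = K₁.card * (x * τ.T i) * (e / τ.T i / x) := by simp; field_simp
      _ ≤ ((a - t₀) + x * (d - a)) * (e / τ.T i / x) := by gcongr
      _ = (a - t₀) * (e / τ.T i / x) + (d - a) * (e / τ.T i) := by field_simp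
      _ ≤ _ := by gcongr
  -- Cut at the first release in `K₂`: by separation all of `K₁` has its deadlines before it, so no
  -- factor `1 / x` is needed.
  · obtain ⟨j, hj, hmin⟩ := K₂.exists_min_image S.release hne
    have hmr : (K₂.card : ℝ) * τ.T i ≤ d - S.release j :=
      S.card_mul_le h₂ ((S.release_lt_deadline j).le.trans (hhi₂ j hj)) hmin hhi₂
    have hkr : (K₁.card : ℝ) * τ.T i ≤ S.release j - t₀ := by
      refine S.card_mul_le h₁ (hta.trans (hlo₂ j hj)) hlo₁ ?_
      intro k hk
      have hlt := (hhi₁ k hk).trans_le (hlo₂ j hj)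
      have hne : k ≠ j := by rintro rfl; exact lt_irrefl _ hlt
      have := S.separation k j hne ((h₁ k hk).trans (h₂ j hj).symm)
      rw [abs_of_neg (by linarith)] at this
      unfold deadline
      linarith
    have hra := hlo₂ j hj
    have hat : 0 ≤ a - t₀ := by linarith
    have hra' : 0 ≤ S.release j - a := by linarith
    calc (K₁.card : ℝ) * e + K₂.card * c
        = K₁.card * τ.T i * (e / τ.T i) + K₂.card * τ.T i * (c / τ.T i) := by field_simp
      _ ≤ (S.release j - t₀) * (e / τ.T i) + (d - S.release j) * (c / τ.T i) := by gcongr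
      _ = (a - t₀) * (e / τ.T i) + (S.release j - a) * (e / τ.T i)
          + (d - S.release j) * (c / τ.T i) := by ring
      _ ≤ (a - t₀) * (e / τ.T i / x) + (S.release j - a) * (c / τ.T i)
          + (d - S.release j) * (c / τ.T i) := by gcongr
      _ = _ := by ring

theorem finite_release_lt [Finite ι] (t : ℝ) : {j | S.release j < t}.Finite := by
  have hfib : ∀ i, {j | S.task j = i ∧ S.release j < t}.Finite := by
    intro i
    by_contra hinf
    obtain ⟨n, hn⟩ := exists_nat_gt (|t| / τ.T i + 1)
    obtain ⟨K, hK, hcard⟩ := Set.Infinite.exists_subset_card_eq hinf n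
    have := S.card_sub_one_mul_le (fun j hj => (hK hj).1) (abs_nonneg t)
      (fun j _ => S.release_nonneg j) (fun j hj => (hK hj).2.le.trans (le_abs_self t))
    have hT := τ.T_pos i
    rw [hcard, sub_zero, ← le_div_iff₀ hT] at this
    linarith
  refine (Set.finite_iUnion hfib).subset fun j hj => ?_
  simp only [mem_iUnion]
  exact ⟨S.task j, rfl, hj⟩

open scoped Classical in
/-- The part of the demand of `j` that the LC mode schedules by a deadline of at most `v`. -/
noncomputable def lcDemand (x v : ℝ) (j : J) : ℝ :=
  if S.IsLC j then
    if S.deadline j ≤ v then S.demand j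
    else if S.virtualDeadline x j ≤ v then min (S.hcBudget j) (S.demand j) else 0
  else if S.virtualDeadline x j ≤ v then S.demand j else 0

open scoped Classical in
/-- The part of the demand of `j` that the HC mode schedules by a deadline of at most `d`. -/
noncomputable def hcDemand (d : ℝ) (j : J) : ℝ :=
  if S.deadline j ≤ d then
    if S.IsLC j then min (S.hcBudget j) (S.demand j) else S.demand j
  else 0

end JobSequence

namespace JobSequence

variable {ι : Type*} {τ : MCTaskSystem ι} {J : Type} (S : JobSequence τ J)

theorem hcDemand_le_demand (d : ℝ) (j : J) : S.hcDemand d j ≤ S.demand j := by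
  have := S.demand_nonneg j
  unfold hcDemand
  split_ifs <;> simp [this]

theorem hcDemand_le_hcBudget (d : ℝ) {j : J} (h : S.IsLC j) : S.hcDemand d j ≤ S.hcBudget j := by
  have := S.hcBudget_nonneg h
  unfold hcDemand
  split_ifs <;> simp [this]

theorem hcDemand_nonneg (d : ℝ) (j : J) : 0 ≤ S.hcDemand d j := by
  unfold hcDemand
  split_ifs with h1 h2
  · exact le_min (S.hcBudget_nonneg h2) (S.demand_nonneg j)
  · exact S.demand_nonneg j
  · exact le_rfl

theorem lcDemand_nonneg (x v : ℝ) (j : J) : 0 ≤ S.lcDemand x v j := by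
  unfold lcDemand
  split_ifs with h1
  · exact S.demand_nonneg j
  · exact le_min (S.hcBudget_nonneg h1) (S.demand_nonneg j)
  · exact le_rfl
  · exact S.demand_nonneg j
  · exact le_rfl

theorem lcDemand_le_demand (x v : ℝ) (j : J) : S.lcDemand x v j ≤ S.demand j := by
  have := S.demand_nonneg j
  unfold lcDemand
  split_ifs <;> simp [this]

end JobSequence

/-! ### Execution, pending jobs and idle instants -/

namespace Schedule

variable {ι : Type*} {τ : MCTaskSystem ι} {J : Type} {σ : Schedule J} {S : JobSequence τ J}

theorem exec_nonneg (j : J) (t : ℝ) : 0 ≤ σ.exec S j t := measureReal_nonneg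

theorem exec_of_le_release {j : J} {t : ℝ} (h : t ≤ S.release j) : σ.exec S j t = 0 := by
  simp [exec, Ico_eq_empty (not_lt.mpr h)]

theorem exec_mono (j : J) : Monotone (σ.exec S j) := by
  intro s t hst
  refine measureReal_mono (inter_subset_inter_right _ (Ico_subset_Ico_right hst)) ?_
  exact ne_top_of_le_ne_top (by simp) (measure_mono inter_subset_right)

theorem exec_le_add (j : J) (s t : ℝ) :
    σ.exec S j t ≤ σ.exec S j s + volume.real ({w | σ.run w = some j} ∩ Ioo s t) := by
  have hsub : {w | σ.run w = some j} ∩ Ico (S.release j) t ⊆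
      ({w | σ.run w = some j} ∩ Ico (S.release j) s) ∪
        (({w | σ.run w = some j} ∩ Ioo s t) ∪ {s}) := by
    rintro w ⟨hw, hr, hwt⟩
    rcases lt_trichotomy w s with h | h | h
    · exact Or.inl ⟨hw, hr, h⟩
    · exact Or.inr (Or.inr h)
    · exact Or.inr (Or.inl ⟨hw, h, hwt⟩)
  have hfin : ∀ (A : Set ℝ) (a b : ℝ), volume (A ∩ Ioo a b) ≠ ⊤ := fun A a b =>
    ne_top_of_le_ne_top (by simp) (measure_mono inter_subset_right)
  have hfin' : ∀ (A : Set ℝ) (a b : ℝ), volume (A ∩ Ico a b) ≠ ⊤ := fun A a b =>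
    ne_top_of_le_ne_top (by simp) (measure_mono inter_subset_right)
  have hfin2 : volume (({w | σ.run w = some j} ∩ Ioo s t) ∪ {s}) ≠ ⊤ :=
    measure_union_ne_top (hfin _ _ _) (by simp)
  calc σ.exec S j t ≤ _ := measureReal_mono hsub (measure_union_ne_top (hfin' _ _ _) hfin2)
    _ ≤ _ := measureReal_union_le _ _
    _ ≤ σ.exec S j s + (volume.real ({w | σ.run w = some j} ∩ Ioo s t) + volume.real {s}) := by
        gcongr
        · exact le_rfl
        · exact measureReal_union_le _ _
    _ = _ := by simp [measureReal_def]

theorem exec_sub_le (j : J) {s t : ℝ} (hst : s ≤ t) : σ.exec S j t ≤ σ.exec S j s + (t - s) := by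
  refine (exec_le_add j s t).trans ?_
  gcongr
  calc volume.real ({w | σ.run w = some j} ∩ Ioo s t) ≤ volume.real (Ioo s t) :=
        measureReal_mono inter_subset_right (by simp)
    _ = t - s := Real.volume_real_Ioo_of_le hst

theorem continuous_exec (j : J) : Continuous (σ.exec S j) := by
  refine (LipschitzWith.of_dist_le_mul (K := 1) fun s t => ?_).continuous
  rw [NNReal.coe_one, one_mul, Real.dist_eq, Real.dist_eq]
  rcases le_total s t with h | h
  · have h1 := exec_mono (σ := σ) (S := S) j h
    have h2 := exec_sub_le (σ := σ) (S := S) j h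
    rw [abs_of_nonpos (by linarith), abs_of_nonpos (by linarith)]
    linarith
  · have h1 := exec_mono (σ := σ) (S := S) j h
    have h2 := exec_sub_le (σ := σ) (S := S) j h
    rw [abs_of_nonneg (by linarith), abs_of_nonneg (by linarith)]
    linarith

theorem exec_eq_of_not_run {j : J} {s t : ℝ} (hst : s ≤ t)
    (h : ∀ w ∈ Ioo s t, σ.run w ≠ some j) : σ.exec S j t = σ.exec S j s := by
  have he : {w | σ.run w = some j} ∩ Ioo s t = ∅ := by
    ext w
    simp only [mem_inter_iff, mem_ofPred_eq, mem_empty_iff_false, iff_false, not_and]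
    exact fun hw hm => h w hm hw
  have := exec_le_add (σ := σ) (S := S) j s t
  rw [he, measureReal_empty, add_zero] at this
  exact this.antisymm (exec_mono j hst)

/-- A job that runs only while it has executed for less than `c` executes for at most `c`. -/
theorem exec_le_max {j : J} {s t c : ℝ} (hst : s ≤ t)
    (h : ∀ w ∈ Ioo s t, σ.run w = some j → σ.exec S j w < c) :
    σ.exec S j t ≤ max (σ.exec S j s) c := by
  by_contra! hlt
  -- From the time at which the execution equals the maximum, the job never runs again.
  obtain ⟨w, hw, hwe⟩ := intermediate_value_Icc hst (continuous_exec (σ := σ) (S := S) j).continuousOn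
    ⟨le_max_left _ c, hlt.le⟩
  refine hlt.ne' ?_
  rw [← hwe]
  refine exec_eq_of_not_run hw.2 fun u hu hrun => ?_
  have h1 := h u ⟨hw.1.trans_lt hu.1, hu.2⟩ hrun
  have h2 := exec_mono (σ := σ) (S := S) j hu.1.le
  rw [hwe] at h2
  exact absurd (h1.trans_le ((le_max_right _ _).trans h2)) (lt_irrefl _)

theorem CutOff.mono {j : J} {s t : ℝ} (h : σ.CutOff S j s) (hst : s ≤ t) : σ.CutOff S j t := by
  obtain ⟨hl, a, b, h1, h2, h3, h4⟩ := h
  exact ⟨hl, a, b, h1, h2, h3.trans hst, h4⟩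

theorem CutOff.hcBudget_le {j : J} {t : ℝ} (h : σ.CutOff S j t) :
    S.hcBudget j ≤ σ.exec S j t := by
  obtain ⟨-, a, b, -, -, h3, -, h4⟩ := h
  exact h4.trans (exec_mono j h3)

theorem not_pending_mono {j : J} {s t : ℝ} (hr : S.release j ≤ s) (h : ¬ σ.Pending S j s)
    (hst : s ≤ t) : ¬ σ.Pending S j t := by
  rintro ⟨-, h2, h3⟩
  exact h ⟨hr, (exec_mono j hst).trans_lt h2, fun hc => h3 (hc.mono hst)⟩

theorem pending_of_exec_lt_hcDemand {j : J} {t d : ℝ} (hr : S.release j ≤ t)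
    (h : σ.exec S j t < S.hcDemand d j) : σ.Pending S j t :=
  ⟨hr, h.trans_le (S.hcDemand_le_demand d j), fun hc =>
    absurd (hc.hcBudget_le.trans_lt h) (not_lt.mpr (S.hcDemand_le_hcBudget d hc.1))⟩

/-- Some job released before `t` is pending and has executed for less than its share of `D`. -/
def Active (σ : Schedule J) (S : JobSequence τ J) (D : J → ℝ) (t : ℝ) : Prop :=
  ∃ j, S.release j < t ∧ σ.Pending S j t ∧ σ.exec S j t < D j

/-- Idleness is the case `D = S.demand` of inactivity, so the existence of a last inactive time also
yields a last idle instant. -/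
theorem idleInstant_iff (t : ℝ) : σ.IdleInstant S t ↔ ¬ σ.Active S S.demand t := by
  unfold IdleInstant Active
  push Not
  refine forall_congr' fun j => imp_congr_right fun _ => ?_
  exact ⟨fun h h' => absurd h' h, fun h h' => absurd h'.2.1 (not_lt.mpr (h h'))⟩

theorem IdleInstant.not_active {t : ℝ} (h : σ.IdleInstant S t) (D : J → ℝ) :
    ¬ σ.Active S D t := by
  rintro ⟨j, h1, h2, -⟩
  exact h j h1 h2

/-- There is a last inactive time in `[p, q]`, if `p` is inactive. -/
theorem exists_last_not_active {D : J → ℝ} {p q : ℝ} (hpq : p ≤ q) (hp : ¬ σ.Active S D p) :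
    ∃ t ∈ Icc p q, ¬ σ.Active S D t ∧ ∀ w ∈ Ioc t q, σ.Active S D w := by
  set A : Set ℝ := {w | w ∈ Icc p q ∧ ¬ σ.Active S D w}
  have hne : A.Nonempty := ⟨p, ⟨le_rfl, hpq⟩, hp⟩
  have hbdd : BddAbove A := ⟨q, fun w hw => hw.1.2⟩
  have hmem : sSup A ∈ Icc p q :=
    ⟨le_csSup hbdd ⟨⟨le_rfl, hpq⟩, hp⟩, csSup_le hne fun w hw => hw.1.2⟩
  refine ⟨sSup A, hmem, ?_, ?_⟩
  · rintro ⟨j, h1, h2, h3⟩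
    -- A job active at the supremum is released strictly before it, hence already active at an
    -- inactive time close to it.
    obtain ⟨w, hw, hjw⟩ := exists_lt_of_lt_csSup hne h1
    have hle := le_csSup hbdd hw
    refine hw.2 ⟨j, hjw, ?_, (exec_mono j hle).trans_lt h3⟩
    by_contra hnp
    exact not_pending_mono hjw.le hnp hle h2
  · intro w hw
    by_contra hn
    exact absurd (le_csSup hbdd ⟨⟨hmem.1.trans hw.1.le, hw.2⟩, hn⟩) (not_le.mpr hw.1)

theorem idleInstant_of_nonpos {t : ℝ} (ht : t ≤ 0) : σ.IdleInstant S t := fun j hj =>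
  absurd (hj.trans_le ht) (not_lt.mpr (S.release_nonneg j))

theorem exists_last_idleInstant (t : ℝ) :
    ∃ p ≤ t, σ.IdleInstant S p ∧ ∀ w ∈ Ioc p t, ¬ σ.IdleInstant S w := by
  have h0 : σ.IdleInstant S (min 0 t) := idleInstant_of_nonpos (min_le_left _ _)
  obtain ⟨p, hp, h1, h2⟩ := exists_last_not_active (min_le_right 0 t) (h0.not_active S.demand)
  refine ⟨p, hp.2, (idleInstant_iff p).mpr h1, fun w hw => ?_⟩
  rw [idleInstant_iff, not_not]
  exact h2 w hw

/-- Trades the key, which changes during execution, for a fixed amount of work: a LC job counts up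
to `hcBudget` by its virtual deadline, and beyond that by its original one. -/
theorem lcKey_le_iff {x v t : ℝ} (hx : x ≤ 1) {j : J}
    (hlt : σ.exec S j t < S.demand j) :
    σ.lcKey S x t j ≤ v ↔ σ.exec S j t < S.lcDemand x v j := by
  have hvd := S.virtualDeadline_le_deadline hx j
  have h0 := exec_nonneg (σ := σ) (S := S) j t
  unfold lcKey JobSequence.lcDemand
  by_cases hl : S.IsLC j
  · by_cases hb : S.hcBudget j ≤ σ.exec S j t
    · simp only [hl, hb, and_self, if_true]
      split_ifs with h1 h2
      · simp [h1, hlt]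
      · simp [h1, hb]
      · simp [h1, h0]
    · simp only [hl, hb, and_false, if_true, if_false]
      rw [not_le] at hb
      split_ifs with h1 h2
      · simp [hlt, hvd.trans h1]
      · simp [h2, hb, hlt]
      · simp [h2, h0]
  · simp only [hl, false_and, if_false]
    split_ifs with h1
    · simp [h1, hlt]
    · simp [h1, h0]

/-! ### Consequences of the scheduling rules: the mode switch and the reserve -/

section
variable [Fintype ι] {β x : ℝ} (H : σ.IsMEBAEDFUVD S β x)
include H

theorem IsMEBAEDFUVD.pending_of_run {j : J} {t : ℝ} (h : σ.run t = some j) :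
    σ.Pending S j t := by
  by_cases ht : t ∈ σ.hc
  · have := H.run_hc t ht
    rw [h] at this
    exact this.1.1
  · have := H.pick_edf t
    rw [← H.run_lc t ht, h] at this
    exact this.1

theorem IsMEBAEDFUVD.exec_le_demand (j : J) (t : ℝ) : σ.exec S j t ≤ S.demand j := by
  rcases le_total t (S.release j) with h | h
  · rw [exec_of_le_release h]
    exact S.demand_nonneg j
  · have := exec_le_max (σ := σ) (j := j) (c := S.demand j) h
      fun w _ hrun => (H.pending_of_run hrun).2.1
    rwa [exec_of_le_release le_rfl, max_eq_right (S.demand_nonneg j)] at this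

theorem IsMEBAEDFUVD.exec_le_maxExec {i : ι} {j : J} {t : ℝ} (hj : S.task j = i)
    (hb : σ.InBusyInterval S j t) : σ.exec S j t ≤ σ.maxExec S i t := by
  refine le_csSup ⟨τ.C i, ?_⟩ ⟨j, ⟨hj, hb⟩, rfl⟩
  rintro _ ⟨k, ⟨hk, -⟩, rfl⟩
  exact (H.exec_le_demand k t).trans (hk ▸ S.demand_le k)

/-- Every time of an interval that the listed jobs fill, but one, adds to their execution. -/
theorem IsMEBAEDFUVD.length_le_sum_exec {F : Finset J} {t d s : ℝ}
    (h : ∀ w ∈ Ioo t d, w ≠ s → ∃ j ∈ F, σ.run w = some j) :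
    d - t ≤ ∑ j ∈ F, σ.exec S j d := by
  have hfin : ∀ j, volume ({w | σ.run w = some j} ∩ Ico (S.release j) d) ≠ ⊤ := fun j =>
    ne_top_of_le_ne_top (by simp) (measure_mono inter_subset_right)
  have hsub : Ioo t d ⊆ (⋃ j ∈ F, {w | σ.run w = some j} ∩ Ico (S.release j) d) ∪ {s} := by
    intro w hw
    by_cases hs : w = s
    · exact Or.inr hs
    · obtain ⟨j, hj, hr⟩ := h w hw hs
      refine Or.inl ?_
      simp only [mem_iUnion]
      exact ⟨j, hj, hr, (H.pending_of_run hr).1, hw.2⟩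
  have hU : volume (⋃ j ∈ F, {w | σ.run w = some j} ∩ Ico (S.release j) d) ≠ ⊤ :=
    (measure_biUnion_lt_top F.finite_toSet fun j _ => (hfin j).lt_top).ne
  calc d - t ≤ volume.real (Ioo t d) := by simp
    _ ≤ _ := measureReal_mono hsub (measure_union_ne_top hU (by simp))
    _ ≤ _ := measureReal_union_le _ _
    _ = volume.real (⋃ j ∈ F, {w | σ.run w = some j} ∩ Ico (S.release j) d) := by
        simp [measureReal_def]
    _ ≤ _ := measureReal_biUnion_finset_le _ _

theorem IsMEBAEDFUVD.mem_hc_of_trigger {t : ℝ} (h : σ.Trigger S β t) : t ∈ σ.hc :=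
  (H.mode t).mpr ⟨t, le_rfl, h, fun _ h1 h2 => absurd h1 (not_lt.mpr h2)⟩

/-- In a stretch without idle instants, there is one mode-switch at most. -/
theorem IsMEBAEDFUVD.exists_modeSwitch {p d : ℝ} (hpd : p ≤ d) (hp : σ.IdleInstant S p)
    (hbusy : ∀ w ∈ Ioc p d, ¬ σ.IdleInstant S w) :
    ∃ s ∈ Icc p d, (∀ w ∈ Ico p s, w ∉ σ.hc) ∧ ∀ w ∈ Ioc s d, w ∈ σ.hc := by
  have hup : ∀ w w', p ≤ w → w ≤ w' → w' ≤ d → w ∈ σ.hc → w' ∈ σ.hc := by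
    intro w w' hpw hww hwd hw
    obtain ⟨s, hs, htr, hid⟩ := (H.mode w).mp hw
    have hps : p ≤ s := by
      by_contra! hsp
      exact hid p hsp hpw hp
    refine (H.mode w').mpr ⟨s, hs.trans hww, htr, fun u hu1 hu2 => ?_⟩
    exact hbusy u ⟨hps.trans_lt hu1, hu2.trans hwd⟩
  -- Inserting `d` covers the case without a switch, where the infimum is `d`.
  set A : Set ℝ := insert d (σ.hc ∩ Icc p d)
  have hne : A.Nonempty := ⟨d, mem_insert _ _⟩
  have hlow : ∀ w ∈ A, p ≤ w := by
    rintro w (rfl | hw)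
    · exact hpd
    · exact hw.2.1
  have hbdd : BddBelow A := ⟨p, hlow⟩
  refine ⟨sInf A, ⟨le_csInf hne hlow, csInf_le hbdd (mem_insert _ _)⟩, ?_, ?_⟩
  · intro w hw hhc
    have hwd : w ≤ d := hw.2.le.trans (csInf_le hbdd (mem_insert _ _))
    exact absurd (csInf_le hbdd (mem_insert_of_mem _ ⟨hhc, hw.1, hwd⟩)) (not_le.mpr hw.2)
  · intro w hw
    obtain ⟨a, ha, haw⟩ := exists_lt_of_csInf_lt hne hw.1
    rcases ha with rfl | ha
    · exact absurd haw (not_lt.mpr hw.2)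
    · exact hup a w ha.2.1 haw.le hw.2 ha.1

/-- The executions in the LC mode of one job of each HC task respect the common reserve. -/
theorem IsMEBAEDFUVD.sum_exec_div_le (hB : 0 ≤ β * τ.UH) {p s : ℝ} (hps : p ≤ s)
    (hbusy : ∀ w ∈ Ioc p s, ¬ σ.IdleInstant S w) (hlc : ∀ w ∈ Ico p s, w ∉ σ.hc)
    {I : Finset ι} (hI : ∀ i ∈ I, τ.crit i = Criticality.HC) {sel : ι → J}
    (hsel : ∀ i ∈ I, S.task (sel i) = i) (hrel : ∀ i ∈ I, p ≤ S.release (sel i)) :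
    ∑ i ∈ I, σ.exec S (sel i) s / τ.T i ≤ β * τ.UH := by
  classical
  set F : ℝ → ℝ := fun t => ∑ i ∈ I, σ.exec S (sel i) t / τ.T i with hF
  have hmono : Monotone F := fun a b hab => Finset.sum_le_sum fun i _ =>
    div_le_div_of_nonneg_right (exec_mono _ hab) (τ.T_pos i).le
  have hcont : Continuous F := continuous_finsetSum _ fun i _ =>
    (continuous_exec (sel i)).div_const _
  have hFp : F p = 0 := Finset.sum_eq_zero fun i hi => by
    rw [exec_of_le_release (hrel i hi), zero_div]
  -- A selected job that runs in the LC mode has not triggered, so it is below its budget. The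
  -- budget subtracts maxima that dominate the other selected executions, so the whole sum is below
  -- the reserve.
  have hrun : ∀ i ∈ I, ∀ w ∈ Ico p s, σ.run w = some (sel i) → F w < β * τ.UH := by
    intro i hi w hw hr
    have hntr : ¬ σ.Trigger S β w := fun h => hlc w hw (H.mem_hc_of_trigger h)
    have hex : σ.exec S (sel i) w < σ.budget S β i w := by
      by_contra! hle
      refine hntr ⟨sel i, ?_, H.pending_of_run hr, Or.inl ?_, ?_⟩
      · unfold JobSequence.IsHC
        rw [hsel i hi]
        exact hI i hi
      · rw [← H.run_lc w (hlc w hw), hr]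
      · rwa [hsel i hi]
    have hother : ∑ k ∈ I.erase i, σ.exec S (sel k) w / τ.T k ≤
        ∑ k with τ.crit k = Criticality.HC ∧ k ≠ i, σ.maxExec S k w / τ.T k := by
      have hnn : ∀ k, 0 ≤ σ.maxExec S k w := fun k => Real.sSup_nonneg (by
        rintro _ ⟨j, -, rfl⟩
        exact exec_nonneg j w)
      calc ∑ k ∈ I.erase i, σ.exec S (sel k) w / τ.T k
          ≤ ∑ k ∈ I.erase i, σ.maxExec S k w / τ.T k := by
            refine Finset.sum_le_sum fun k hk => ?_
            have hkI := Finset.mem_of_mem_erase hk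
            refine div_le_div_of_nonneg_right ?_ (τ.T_pos k).le
            rcases lt_or_ge w (S.release (sel k)) with h | h
            · rw [exec_of_le_release h.le]
              exact hnn k
            · refine H.exec_le_maxExec (hsel k hkI) ⟨h, fun u hu1 hu2 => hbusy u ⟨?_, ?_⟩⟩
              · exact (hrel k hkI).trans_lt hu1
              · exact hu2.trans hw.2.le
        _ ≤ _ := by
            refine Finset.sum_le_sum_of_subset_of_nonneg ?_ fun k _ _ =>
              div_nonneg (hnn k) (τ.T_pos k).le
            intro k hk
            simp only [Finset.mem_filter, Finset.mem_univ, true_and]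
            exact ⟨hI k (Finset.mem_of_mem_erase hk), Finset.ne_of_mem_erase hk⟩
    have hT := τ.T_pos i
    have : σ.exec S (sel i) w / τ.T i < β * τ.UH -
        ∑ k with τ.crit k = Criticality.HC ∧ k ≠ i, σ.maxExec S k w / τ.T k := by
      rw [div_lt_iff₀ hT, mul_comm]
      unfold budget at hex
      convert hex
    have hsplit : F w = σ.exec S (sel i) w / τ.T i +
        ∑ k ∈ I.erase i, σ.exec S (sel k) w / τ.T k := (Finset.add_sum_erase I _ hi).symm
    linarith
  by_contra! hlt
  -- Once the sum reaches the reserve, no selected job can run, so the sum stays there.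
  obtain ⟨t, ht, htF⟩ := intermediate_value_Icc hps hcont.continuousOn
    (show β * τ.UH ∈ Icc (F p) (F s) from ⟨hFp ▸ hB, hlt.le⟩)
  refine hlt.ne' ?_
  change F s = _
  rw [← htF]
  refine Finset.sum_congr rfl fun i hi => ?_
  congr 1
  refine exec_eq_of_not_run ht.2 fun w hw hr => ?_
  have h1 := hrun i hi w ⟨ht.1.trans hw.1.le, hw.2⟩ hr
  have h2 := hmono hw.1.le
  linarith

end

end Schedule

/-! ### Work per job of a task, and the resulting utilizations -/

namespace MCTaskSystem

variable {ι : Type*} (τ : MCTaskSystem ι)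

/-- What a job of task `i` may execute for, if it is served in the LC mode only by its virtual
deadline and the HC tasks are limited to `e`. -/
noncomputable def earlyWork (e : ι → ℝ) (i : ι) : ℝ :=
  if τ.crit i = Criticality.HC then e i else τ.α i * τ.C i

/-- What a job of task `i` may execute for in the HC mode. -/
noncomputable def hcWork (i : ι) : ℝ :=
  if τ.crit i = Criticality.HC then τ.C i else τ.α i * τ.C i

/-- What the LC mode guarantees to a job of task `i` beyond the guarantee of the HC mode. -/
noncomputable def surplusWork (i : ι) : ℝ :=
  if τ.crit i = Criticality.HC then 0 else (1 - τ.α i) * τ.C i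

variable {τ}

theorem crit_eq_LC {i : ι} (h : τ.crit i ≠ Criticality.HC) : τ.crit i = Criticality.LC := by
  cases hc : τ.crit i
  · rfl
  · exact absurd hc h

theorem earlyWork_nonneg {e : ι → ℝ} (he : ∀ i, 0 ≤ e i) (i : ι) : 0 ≤ τ.earlyWork e i := by
  unfold earlyWork
  split_ifs with h
  · exact he i
  · exact mul_nonneg (τ.α_nonneg i (crit_eq_LC h)) (τ.C_pos i).le

theorem earlyWork_le_hcWork {e : ι → ℝ} (he : ∀ i, e i ≤ τ.C i) (i : ι) :
    τ.earlyWork e i ≤ τ.hcWork i := by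
  unfold earlyWork hcWork
  split_ifs with h
  · exact he i
  · exact le_rfl

theorem surplusWork_nonneg (i : ι) : 0 ≤ τ.surplusWork i := by
  unfold surplusWork
  split_ifs with h
  · exact le_rfl
  · exact mul_nonneg (sub_nonneg.mpr (τ.α_le_one i (crit_eq_LC h))) (τ.C_pos i).le

theorem sum_ite_crit [Fintype ι] (f g : ι → ℝ) :
    ∑ i, (if τ.crit i = Criticality.HC then f i else g i) =
      ∑ i with τ.crit i = Criticality.HC, f i + ∑ i with τ.crit i = Criticality.LC, g i := by
  rw [Finset.sum_ite]
  congr 1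
  refine Finset.sum_congr (Finset.filter_congr fun i _ => ?_) fun _ _ => rfl
  exact ⟨crit_eq_LC, fun h h' => by simp [h] at h'⟩

theorem sum_alpha_mul [Fintype ι] (hUL : 0 < τ.UL) :
    ∑ i with τ.crit i = Criticality.LC, τ.α i * (τ.C i / τ.T i) = τ.alphaStar * τ.UL := by
  rw [alphaStar, div_mul_cancel₀ _ hUL.ne']

theorem sum_earlyWork_div [Fintype ι] (hUL : 0 < τ.UL) (e : ι → ℝ) :
    ∑ i, τ.earlyWork e i / τ.T i =
      ∑ i with τ.crit i = Criticality.HC, e i / τ.T i + τ.alphaStar * τ.UL := by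
  rw [← sum_alpha_mul hUL, ← sum_ite_crit]
  refine Finset.sum_congr rfl fun i _ => ?_
  unfold earlyWork
  split_ifs
  · rfl
  · ring

theorem sum_hcWork_div [Fintype ι] (hUL : 0 < τ.UL) :
    ∑ i, τ.hcWork i / τ.T i = τ.UH + τ.alphaStar * τ.UL :=
  -- `earlyWork` with `e = C` is `hcWork` by definition.
  sum_earlyWork_div hUL τ.C

theorem sum_surplusWork_div [Fintype ι] (hUL : 0 < τ.UL) :
    ∑ i, τ.surplusWork i / τ.T i = τ.UL - τ.alphaStar * τ.UL := by
  have h : ∑ i, τ.surplusWork i / τ.T i + ∑ i, τ.earlyWork 0 i / τ.T i = τ.UL := by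
    have hsum := sum_ite_crit (τ := τ) 0 fun i => τ.C i / τ.T i
    simp only [Pi.zero_apply, Finset.sum_const_zero, zero_add] at hsum
    rw [UL, ← hsum, ← Finset.sum_add_distrib]
    refine Finset.sum_congr rfl fun i _ => ?_
    unfold earlyWork surplusWork
    split_ifs
    · simp
    · ring
  rw [sum_earlyWork_div hUL] at h
  simp only [Pi.zero_apply, zero_div, Finset.sum_const_zero, zero_add] at h
  linarith

end MCTaskSystem

/-! ### The demand bound -/

namespace JobSequence

variable {ι : Type*} {τ : MCTaskSystem ι} {J : Type} (S : JobSequence τ J)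

open scoped Classical in
/-- Bound on the execution of `j` before `d`, when jobs released before `a` count with `e`, jobs
released from `a` on count with `c`, and jobs with early deadlines count with an additional `g`. -/
noncomputable def jobBound (x a d : ℝ) (e c g : ι → ℝ) (j : J) : ℝ :=
  (if S.release j < a ∧ S.virtualDeadline x j ≤ a + x * (d - a) then e (S.task j) else 0) +
    (if a ≤ S.release j ∧ S.deadline j ≤ d then c (S.task j) else 0) +
    (if S.deadline j ≤ a + x * (d - a) then g (S.task j) else 0)

/-- The counting bounds are applied task by task; the surplus `g` is due by `a + x * (d - a)`, so it
is charged at full rate over `[t₀, a)` and at rate `x` over `[a, d)`. -/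
theorem sum_jobBound_le [Fintype ι] {x t₀ a d : ℝ} {e c g : ι → ℝ} {F : Finset J}
    (hx0 : 0 ≤ x) (hx1 : x ≤ 1) (hta : t₀ ≤ a) (had : a ≤ d) (he : ∀ i, 0 ≤ e i)
    (hec : ∀ i, e i ≤ c i) (hg : ∀ i, 0 ≤ g i) (hxe : x = 0 → ∀ i, e i = 0)
    (hF : ∀ j ∈ F, t₀ ≤ S.release j) :
    ∑ j ∈ F, S.jobBound x a d e c g j ≤
      (a - t₀) * ((∑ i, e i / τ.T i) / x + ∑ i, g i / τ.T i) +
        (d - a) * (∑ i, c i / τ.T i + x * ∑ i, g i / τ.T i) := by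
  classical
  have hrhs : (a - t₀) * ((∑ i, e i / τ.T i) / x + ∑ i, g i / τ.T i) +
        (d - a) * (∑ i, c i / τ.T i + x * ∑ i, g i / τ.T i) =
      ∑ i, ((a - t₀) * (e i / τ.T i / x) + (d - a) * (c i / τ.T i) +
        (a + x * (d - a) - t₀) * (g i / τ.T i)) := by
    simp only [Finset.sum_add_distrib, ← Finset.mul_sum, ← Finset.sum_div]
    ring
  rw [hrhs, ← Finset.sum_fiberwise F S.task]
  refine Finset.sum_le_sum fun i _ => ?_
  have hT := τ.T_pos i
  set Fi := F.filter fun j => S.task j = i with hFi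
  have htask : ∀ j ∈ Fi, S.task j = i := fun j hj => (Finset.mem_filter.mp hj).2
  have hlo : ∀ j ∈ Fi, t₀ ≤ S.release j := fun j hj => hF j (Finset.mem_filter.mp hj).1
  set K₁ := Fi.filter fun j => S.release j < a ∧ S.virtualDeadline x j ≤ a + x * (d - a)
  set K₂ := Fi.filter fun j => a ≤ S.release j ∧ S.deadline j ≤ d
  set K₃ := Fi.filter fun j => S.deadline j ≤ a + x * (d - a)
  have hsum : ∑ j ∈ Fi, S.jobBound x a d e c g j =
      K₁.card * e i + K₂.card * c i + K₃.card * g i := by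
    have : ∀ j ∈ Fi, S.jobBound x a d e c g j =
        (if S.release j < a ∧ S.virtualDeadline x j ≤ a + x * (d - a) then e i else 0) +
        (if a ≤ S.release j ∧ S.deadline j ≤ d then c i else 0) +
        (if S.deadline j ≤ a + x * (d - a) then g i else 0) := by
      intro j hj
      unfold jobBound
      rw [htask j hj]
    rw [Finset.sum_congr rfl this]
    simp only [Finset.sum_add_distrib, ← Finset.sum_filter, Finset.sum_const, nsmul_eq_mul]
    rfl
  rw [hsum]
  have h12 := S.card_mul_add_card_mul_le (K₁ := K₁) (K₂ := K₂) (i := i) (t₀ := t₀)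
    (fun j hj => htask j (Finset.mem_filter.mp hj).1)
    (fun j hj => htask j (Finset.mem_filter.mp hj).1) hx0 hx1 hta had (he i) (hec i)
    (fun h => hxe h i) (fun j hj => hlo j (Finset.mem_filter.mp hj).1)
    (fun j hj => (Finset.mem_filter.mp hj).2.1) (fun j hj => (Finset.mem_filter.mp hj).2.2)
    (fun j hj => (Finset.mem_filter.mp hj).2.1) (fun j hj => (Finset.mem_filter.mp hj).2.2)
  have hxd : 0 ≤ x * (d - a) := mul_nonneg hx0 (by linarith)
  have h3 : (K₃.card : ℝ) * τ.T i ≤ a + x * (d - a) - t₀ :=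
    S.card_mul_le (fun j hj => htask j (Finset.mem_filter.mp hj).1) (by linarith)
      (fun j hj => hlo j (Finset.mem_filter.mp hj).1) (fun j hj => (Finset.mem_filter.mp hj).2)
  have h3' : (K₃.card : ℝ) * g i ≤ (a + x * (d - a) - t₀) * (g i / τ.T i) := by
    calc (K₃.card : ℝ) * g i = (K₃.card * τ.T i) * (g i / τ.T i) := by field_simp
      _ ≤ _ := mul_le_mul_of_nonneg_right h3 (div_nonneg (hg i) hT.le)
  linarith

theorem hcDemand_le_jobBound {x a d : ℝ} {e : ι → ℝ} {j : J} (h : a ≤ S.release j) :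
    S.hcDemand d j ≤ S.jobBound x a d (τ.earlyWork e) τ.hcWork τ.surplusWork j := by
  have hg := τ.surplusWork_nonneg (S.task j)
  have hc : S.hcDemand d j ≤ if a ≤ S.release j ∧ S.deadline j ≤ d then
      τ.hcWork (S.task j) else 0 := by
    unfold hcDemand MCTaskSystem.hcWork
    by_cases hd : S.deadline j ≤ d
    · by_cases hl : S.IsLC j
      · have hl' : τ.crit (S.task j) = Criticality.LC := hl
        simp [hl, hl', hd, h, hcBudget]
      · have hh : τ.crit (S.task j) = Criticality.HC := (S.isHC_iff_not_isLC j).mpr hl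
        simp [hl, hh, hd, h, S.demand_le j]
    · simp [hd]
  have hn : ¬ S.release j < a := not_lt.mpr h
  unfold jobBound
  simp only [hn, false_and, if_false, zero_add]
  split_ifs at hc ⊢ <;> linarith

theorem demand_le_jobBound {x a d : ℝ} {e : ι → ℝ} {j : J} (hx : x ≤ 1) (hl : S.IsLC j)
    (h : S.release j < a) (hd : S.deadline j ≤ a + x * (d - a)) :
    S.demand j ≤ S.jobBound x a d (τ.earlyWork e) τ.hcWork τ.surplusWork j := by
  have hn : ¬ a ≤ S.release j := not_le.mpr h
  have hl' : τ.crit (S.task j) = Criticality.LC := hl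
  have hv := (S.virtualDeadline_le_deadline hx j).trans hd
  have hC := S.demand_le j
  unfold jobBound
  simp only [h, hv, hd, hn, and_self, false_and, if_true, if_false, add_zero]
  simp only [MCTaskSystem.earlyWork, MCTaskSystem.surplusWork, hl', reduceCtorEq, if_false]
  linarith

/-- Here `y` stands for the execution up to the mode switch and `z` for that up to `d`. Jobs
released before `a` do not run after the switch (`hdone`); later ones may run up to their HC-mode
demand. -/
theorem le_jobBound {x a d y z : ℝ} {e : ι → ℝ} {j : J} (hx0 : 0 ≤ x) (hx1 : x ≤ 1) (had : a ≤ d)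
    (hxe : x = 0 → ∀ i, τ.earlyWork e i = 0)
    (hL : y ≤ S.lcDemand x (a + x * (d - a)) j) (he : S.IsHC j → y ≤ e (S.task j))
    (hz : z ≤ max y (S.hcDemand d j)) (hdone : S.release j < a → z ≤ y) :
    z ≤ S.jobBound x a d (τ.earlyWork e) τ.hcWork τ.surplusWork j := by
  set v := a + x * (d - a) with hvdef
  have hg := τ.surplusWork_nonneg (S.task j)
  have hvd : v ≤ d := by nlinarith
  have hdv := S.virtualDeadline_le_deadline hx1 j
  have hC := S.demand_le j
  have hT := τ.T_pos (S.task j)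
  rcases lt_or_ge (S.release j) a with h | h
  · refine (hdone h).trans ?_
    by_cases hl : S.IsLC j
    · have hl' : τ.crit (S.task j) = Criticality.LC := hl
      by_cases hd : S.deadline j ≤ v
      · refine le_trans ?_ (S.demand_le_jobBound hx1 hl h hd)
        simpa [lcDemand, hl, hd] using hL
      · refine hL.trans ?_
        unfold jobBound lcDemand
        rw [← hvdef]
        simp only [hl, hd, h, not_le.mpr h, true_and, false_and, if_true, if_false, add_zero,
          MCTaskSystem.earlyWork, hl', reduceCtorEq]
        split_ifs
        · exact min_le_left _ _
        · exact le_rfl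
    · have hh : S.IsHC j := (S.isHC_iff_not_isLC j).mpr hl
      have hh' : τ.crit (S.task j) = Criticality.HC := hh
      have he' := he hh
      unfold jobBound
      unfold lcDemand at hL
      rw [← hvdef]
      simp only [hl, h, not_le.mpr h, true_and, false_and, if_true, if_false, add_zero,
          MCTaskSystem.earlyWork, MCTaskSystem.surplusWork, hh', ite_self] at hL ⊢
      split_ifs at hL ⊢
      · exact he'
      · exact hL
  · refine hz.trans (max_le ?_ (S.hcDemand_le_jobBound h))
    by_cases hd : S.deadline j ≤ d
    · by_cases hl : S.IsLC j
      · have hl' : τ.crit (S.task j) = Criticality.LC := hl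
        refine hL.trans ?_
        unfold jobBound lcDemand
        rw [← hvdef]
        simp only [hl, hd, h, not_lt.mpr h, and_self, false_and, if_true, if_false, zero_add,
          MCTaskSystem.hcWork, MCTaskSystem.surplusWork, hl', reduceCtorEq]
        split_ifs
        · linarith
        · rw [add_zero]
          exact min_le_left _ _
        · have := S.hcBudget_nonneg hl
          rw [add_zero]
          exact this
      · have hh : τ.crit (S.task j) = Criticality.HC := (S.isHC_iff_not_isLC j).mpr hl
        refine (hL.trans (S.lcDemand_le_demand _ _ _)).trans ?_
        unfold jobBound
        simp only [hd, h, not_lt.mpr h, and_self, false_and, if_true, if_false, zero_add,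
          MCTaskSystem.hcWork, MCTaskSystem.surplusWork, hh, ite_self, add_zero]
        exact hC
    · have hy : y ≤ 0 := by
        have hdv' : ¬ S.deadline j ≤ v := fun h' => hd (h'.trans hvd)
        rcases hx0.eq_or_lt with hx | hx
        · have h0 := hxe hx.symm (S.task j)
          by_cases hl : S.IsLC j
          · have hl' : τ.crit (S.task j) = Criticality.LC := hl
            simp only [MCTaskSystem.earlyWork, hl', reduceCtorEq, if_false] at h0
            unfold lcDemand at hL
            simp only [hl, hdv', if_true, if_false, hcBudget, h0] at hL
            split_ifs at hL
            · exact hL.trans (min_le_left _ _)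
            · exact hL
          · have hh : S.IsHC j := (S.isHC_iff_not_isLC j).mpr hl
            have hh' : τ.crit (S.task j) = Criticality.HC := hh
            simp only [MCTaskSystem.earlyWork, hh', if_true] at h0
            exact (he hh).trans h0.le
        · have hvv : ¬ S.virtualDeadline x j ≤ v := by
            intro hle
            refine hd ?_
            unfold virtualDeadline at hle
            unfold deadline
            have : x * (S.release j + τ.T (S.task j)) ≤ x * d := by nlinarith
            exact le_of_mul_le_mul_left this hx
          simpa [lcDemand, hdv', hvv] using hL
      refine hy.trans ((S.hcDemand_nonneg d j).trans (S.hcDemand_le_jobBound h))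

end JobSequence

/-! ### What the dispatcher runs in each mode -/

namespace Schedule

variable {ι : Type*} {τ : MCTaskSystem ι} {J : Type} {σ : Schedule J} {S : JobSequence τ J}

/-- Had the job been released before `t`, it would have been active at `t`, because pending status
and unmet shares persist backwards to the release. -/
theorem le_release_of_not_active {D : J → ℝ} {j : J} {t w : ℝ} (h : ¬ σ.Active S D t)
    (htw : t ≤ w) (hp : σ.Pending S j w) (hlt : σ.exec S j w < D j) : t ≤ S.release j := by
  by_contra! hr
  refine h ⟨j, hr, ?_, (exec_mono j htw).trans_lt hlt⟩
  by_contra hn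
  exact not_pending_mono hr.le hn htw hp

variable [Fintype ι] {β x : ℝ} (H : σ.IsMEBAEDFUVD S β x)
include H

theorem IsMEBAEDFUVD.exists_run_lc {w v : ℝ} (hx : x ≤ 1) (hw : w ∉ σ.hc) {k : J}
    (hk : σ.Pending S k w) (hkey : σ.lcKey S x w k ≤ v) :
    ∃ j, σ.run w = some j ∧ σ.exec S j w < S.lcDemand x v j := by
  have hp := H.pick_edf w
  rw [← H.run_lc w hw] at hp
  cases hr : σ.run w with
  | none =>
    rw [hr] at hp
    exact absurd hk (hp k)
  | some j =>
    rw [hr] at hp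
    exact ⟨j, rfl, (lcKey_le_iff hx hp.1.2.1).mp ((hp.2 k hk).trans hkey)⟩

theorem IsMEBAEDFUVD.exists_run_hc {w d : ℝ} (hw : w ∈ σ.hc) {k : J}
    (hk : S.release k ≤ w) (hlt : σ.exec S k w < S.hcDemand d k) :
    ∃ j, σ.run w = some j ∧ σ.exec S j w < S.hcDemand d j := by
  have helig : σ.Pending S k w ∧ (S.IsLC k → σ.exec S k w < S.hcBudget k) :=
    ⟨pending_of_exec_lt_hcDemand hk hlt, fun hl => hlt.trans_le (S.hcDemand_le_hcBudget d hl)⟩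
  have hkd : S.deadline k ≤ d := by
    by_contra hd
    simp only [JobSequence.hcDemand, hd, if_false] at hlt
    exact absurd hlt (not_lt.mpr (exec_nonneg k w))
  have hp := H.run_hc w hw
  cases hr : σ.run w with
  | none =>
    rw [hr] at hp
    exact absurd helig (hp k)
  | some j =>
    rw [hr] at hp
    refine ⟨j, rfl, ?_⟩
    have hjd := (hp.2 k helig).trans hkd
    by_cases hl : S.IsLC j
    · simp [JobSequence.hcDemand, hjd, hl, hp.1.2 hl, hp.1.1.2.1]
    · simp [JobSequence.hcDemand, hjd, hl, hp.1.1.2.1]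

/-- The LC mode of a busy interval complies with HC execution bounds within the reserve. -/
theorem IsMEBAEDFUVD.exists_exec_le (hB : 0 ≤ β * τ.UH) {p s : ℝ} (hps : p ≤ s)
    (hbusy : ∀ w ∈ Ioc p s, ¬ σ.IdleInstant S w) (hlc : ∀ w ∈ Ico p s, w ∉ σ.hc) :
    ∃ e : ι → ℝ, (∀ i, 0 ≤ e i) ∧ (∀ i, e i ≤ τ.C i) ∧
      (∀ j, S.IsHC j → p ≤ S.release j → σ.exec S j s ≤ e (S.task j)) ∧
      ∑ i with τ.crit i = Criticality.HC, e i / τ.T i ≤ β * τ.UH := by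
  classical
  have hfin : ∀ i, {j | S.release j < s ∧ p ≤ S.release j ∧ S.task j = i}.Finite := fun i =>
    (S.finite_release_lt s).subset fun j hj => hj.1
  have hmax : ∀ i, ∃ j : Option J, (∀ k, j = some k → p ≤ S.release k ∧ S.task k = i) ∧
      ∀ k, S.release k < s → p ≤ S.release k → S.task k = i →
        ∃ m, j = some m ∧ σ.exec S k s ≤ σ.exec S m s := by
    intro i
    rcases Set.eq_empty_or_nonempty {j | S.release j < s ∧ p ≤ S.release j ∧ S.task j = i} with
      h | h
    · refine ⟨none, by simp, fun k h1 h2 h3 => ?_⟩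
      exact absurd (show k ∈ {j | S.release j < s ∧ p ≤ S.release j ∧ S.task j = i} from
        ⟨h1, h2, h3⟩) (by simp [h])
    · obtain ⟨m, hm, hmax⟩ := Set.exists_max_image _ (fun j => σ.exec S j s) (hfin i) h
      refine ⟨some m, ?_, fun k h1 h2 h3 => ⟨m, rfl, hmax k ⟨h1, h2, h3⟩⟩⟩
      rintro k hk
      cases hk
      exact hm.2
  choose sel hsel hselmax using hmax
  -- The maximum over the finitely many jobs of the task released in `[p, s)`, or `0` if there is
  -- none.
  let e : ι → ℝ := fun i => (sel i).elim 0 fun k => σ.exec S k s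
  have hex : ∀ i k, sel i = some k → e i = σ.exec S k s := fun i k h => by simp [e, h]
  refine ⟨e, ?_, ?_, ?_, ?_⟩
  · intro i
    cases h : sel i with
    | none => simp [e, h]
    | some k => rw [hex i k h]; exact exec_nonneg k s
  · intro i
    cases h : sel i with
    | none => simpa [e, h] using (τ.C_pos i).le
    | some k =>
      rw [hex i k h, ← (hsel i k h).2]
      exact (H.exec_le_demand k s).trans (S.demand_le k)
  · intro j _ hj
    rcases lt_or_ge (S.release j) s with h | h
    · obtain ⟨m, hm, hle⟩ := hselmax _ j h hj rfl
      rw [hex _ m hm]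
      exact hle
    · rw [exec_of_le_release h]
      cases h : sel (S.task j) with
      | none => simp [e, h]
      | some k => rw [hex _ k h]; exact exec_nonneg k s
  · rcases isEmpty_or_nonempty J with hJ | ⟨⟨j₀⟩⟩
    · refine le_of_eq_of_le (Finset.sum_eq_zero fun i _ => ?_) hB
      cases h : sel i with
      | none => simp [e, h]
      | some k => exact isEmptyElim k
    · set I : Finset ι := Finset.univ.filter fun i => τ.crit i = Criticality.HC ∧ sel i ≠ none
      let pickJob : ι → J := fun i => (sel i).getD j₀
      have hpick : ∀ i ∈ I, sel i = some (pickJob i) := by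
        intro i hi
        have := (Finset.mem_filter.mp hi).2.2
        cases h : sel i with
        | none => exact absurd h this
        | some k => simp [pickJob, h]
      have hsum := H.sum_exec_div_le hB hps hbusy hlc (I := I) (sel := pickJob)
        (fun i hi => (Finset.mem_filter.mp hi).2.1)
        (fun i hi => (hsel i _ (hpick i hi)).2) (fun i hi => (hsel i _ (hpick i hi)).1)
      refine le_of_eq_of_le ?_ hsum
      rw [← Finset.sum_subset (s₁ := I)]
      · exact Finset.sum_congr rfl fun i hi => by rw [hex i _ (hpick i hi)]
      · intro i hi
        simpa using (Finset.mem_filter.mp hi).2.1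
      · intro i hi hiI
        have hn : sel i = none := by
          by_contra hne
          exact hiI (Finset.mem_filter.mpr ⟨Finset.mem_univ _, (Finset.mem_filter.mp hi).2, hne⟩)
        simp [e, hn]

end Schedule

/-! ### Overload contradicts the schedulability test -/

namespace Schedule

variable {ι : Type*} {τ : MCTaskSystem ι} {J : Type} {σ : Schedule J} {S : JobSequence τ J}

/-- A job still owed HC-mode work is below `hcBudget` if it is LC, so its key is the virtual
deadline, at most `r + x * (d - r)` for release `r`. -/
theorem lcKey_le_of_exec_lt_hcDemand {x v d w : ℝ} (hx : 0 ≤ x) {j : J}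
    (hlt : σ.exec S j w < S.hcDemand d j)
    (hv : S.release j + x * (d - S.release j) ≤ v) : σ.lcKey S x w j ≤ v := by
  have hjd : S.deadline j ≤ d := by
    by_contra hd
    simp only [JobSequence.hcDemand, hd, if_false] at hlt
    exact absurd hlt (not_lt.mpr (exec_nonneg j w))
  have hkey : σ.lcKey S x w j = S.virtualDeadline x j := by
    refine if_neg fun h => ?_
    exact absurd (hlt.trans_le (S.hcDemand_le_hcBudget d h.1)) (not_lt.mpr h.2)
  rw [hkey]
  refine le_trans ?_ hv
  unfold JobSequence.virtualDeadline
  unfold JobSequence.deadline at hjd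
  gcongr
  linarith

theorem exec_le_max_of_run {D : J → ℝ} {t s : ℝ} (hts : t ≤ s)
    (h : ∀ w ∈ Ioo t s, ∃ j, σ.run w = some j ∧ σ.exec S j w < D j) (j : J) :
    σ.exec S j s ≤ max (σ.exec S j t) (D j) := by
  refine exec_le_max hts fun w hw hj => ?_
  obtain ⟨k, hk, hlt⟩ := h w hw
  rw [hj] at hk
  cases hk
  exact hlt

/-- The processor cannot be fully used by jobs whose bounds add up to less than one per unit. -/
theorem IsMEBAEDFUVD.not_fully_used [Fintype ι] {β x : ℝ} (H : σ.IsMEBAEDFUVD S β x)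
    (hx0 : 0 ≤ x) (hx1 : x ≤ 1) {t₀ a d s : ℝ} {e c g : ι → ℝ} (hta : t₀ ≤ a) (had : a ≤ d)
    (he : ∀ i, 0 ≤ e i) (hec : ∀ i, e i ≤ c i) (hg : ∀ i, 0 ≤ g i)
    (hxe : x = 0 → ∀ i, e i = 0) (hlc : (∑ i, e i / τ.T i) / x + ∑ i, g i / τ.T i ≤ 1)
    (hhc : ∑ i, c i / τ.T i + x * ∑ i, g i / τ.T i ≤ 1)
    (hrun : ∀ w ∈ Ioo t₀ d, w ≠ s → ∃ j, σ.run w = some j ∧ t₀ ≤ S.release j)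
    (hle : ∀ j, t₀ ≤ S.release j → σ.exec S j d ≤ S.jobBound x a d e c g j) {j₀ : J}
    (hj₀ : t₀ ≤ S.release j₀) (hj₀d : S.release j₀ < d)
    (hlt : σ.exec S j₀ d < S.jobBound x a d e c g j₀) : False := by
  have hfin : {j | S.release j < d ∧ t₀ ≤ S.release j}.Finite :=
    (S.finite_release_lt d).subset fun j hj => hj.1
  have hF : ∀ j, j ∈ hfin.toFinset ↔ S.release j < d ∧ t₀ ≤ S.release j := by simp
  have h1 : d - t₀ ≤ ∑ j ∈ hfin.toFinset, σ.exec S j d := by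
    refine H.length_le_sum_exec (s := s) fun w hw hws => ?_
    obtain ⟨j, hj, hr⟩ := hrun w hw hws
    exact ⟨j, (hF j).mpr ⟨(H.pending_of_run hj).1.trans_lt hw.2, hr⟩, hj⟩
  have h2 : ∑ j ∈ hfin.toFinset, σ.exec S j d <
      ∑ j ∈ hfin.toFinset, S.jobBound x a d e c g j :=
    Finset.sum_lt_sum (fun j hj => hle j ((hF j).mp hj).2) ⟨j₀, (hF j₀).mpr ⟨hj₀d, hj₀⟩, hlt⟩
  have h3 := S.sum_jobBound_le hx0 hx1 hta had he hec hg hxe fun j hj => ((hF j).mp hj).2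
  have h4 : (a - t₀) * ((∑ i, e i / τ.T i) / x + ∑ i, g i / τ.T i) ≤ (a - t₀) * 1 :=
    mul_le_mul_of_nonneg_left hlc (by linarith)
  have h5 : (d - a) * (∑ i, c i / τ.T i + x * ∑ i, g i / τ.T i) ≤ (d - a) * 1 :=
    mul_le_mul_of_nonneg_left hhc (by linarith)
  linarith

/-- Numerical form of the schedulability test. -/
structure TestPassed [Fintype ι] (τ : MCTaskSystem ι) (β x : ℝ) : Prop where
  x_nonneg : 0 ≤ x
  x_le_one : x ≤ 1
  UL_pos : 0 < τ.UL
  reserve_nonneg : 0 ≤ β * τ.UH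
  slack_nonneg : 0 ≤ 1 - (τ.UL - τ.alphaStar * τ.UL)
  lc : β * τ.UH + τ.alphaStar * τ.UL ≤ x * (1 - (τ.UL - τ.alphaStar * τ.UL))
  hc : τ.UH + τ.alphaStar * τ.UL + x * (τ.UL - τ.alphaStar * τ.UL) ≤ 1

theorem TestPassed.sum_earlyWork_le [Fintype ι] {β x : ℝ} (P : TestPassed τ β x) {e : ι → ℝ}
    (he : ∑ i with τ.crit i = Criticality.HC, e i / τ.T i ≤ β * τ.UH) :
    ∑ i, τ.earlyWork e i / τ.T i ≤ x * (1 - (τ.UL - τ.alphaStar * τ.UL)) := by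
  rw [MCTaskSystem.sum_earlyWork_div P.UL_pos]
  linarith [P.lc]

/-- At `x = 0` the LC-mode condition bounds a sum of nonnegative terms by zero. -/
theorem TestPassed.earlyWork_eq_zero [Fintype ι] {β x : ℝ} (P : TestPassed τ β x) {e : ι → ℝ}
    (he0 : ∀ i, 0 ≤ e i)
    (he : ∑ i with τ.crit i = Criticality.HC, e i / τ.T i ≤ β * τ.UH) (hx : x = 0) (i : ι) :
    τ.earlyWork e i = 0 := by
  have h := P.sum_earlyWork_le he
  rw [hx, zero_mul] at h
  have hnn : ∀ i ∈ Finset.univ, 0 ≤ τ.earlyWork e i / τ.T i := fun i _ =>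
    div_nonneg (MCTaskSystem.earlyWork_nonneg he0 i) (τ.T_pos i).le
  have hz := (Finset.sum_eq_zero_iff_of_nonneg hnn).mp (h.antisymm (Finset.sum_nonneg hnn)) i
    (Finset.mem_univ i)
  exact (div_eq_zero_iff.mp hz).resolve_right (τ.T_pos i).ne'

theorem TestPassed.lc_rate_le [Fintype ι] {β x : ℝ} (P : TestPassed τ β x) {e : ι → ℝ}
    (he : ∑ i with τ.crit i = Criticality.HC, e i / τ.T i ≤ β * τ.UH) :
    (∑ i, τ.earlyWork e i / τ.T i) / x + ∑ i, τ.surplusWork i / τ.T i ≤ 1 := by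
  have h := P.sum_earlyWork_le he
  rw [MCTaskSystem.sum_surplusWork_div P.UL_pos]
  have : (∑ i, τ.earlyWork e i / τ.T i) / x ≤ 1 - (τ.UL - τ.alphaStar * τ.UL) :=
    div_le_of_le_mul₀ P.x_nonneg P.slack_nonneg (by linarith)
  linarith

theorem TestPassed.hc_rate_le [Fintype ι] {β x : ℝ} (P : TestPassed τ β x) :
    ∑ i, τ.hcWork i / τ.T i + x * ∑ i, τ.surplusWork i / τ.T i ≤ 1 := by
  rw [MCTaskSystem.sum_surplusWork_div P.UL_pos, MCTaskSystem.sum_hcWork_div P.UL_pos]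
  exact P.hc

/-- `[t₀, d)` cannot be filled by jobs whose LC-mode execution, LC-mode bounds and HC-mode bounds
are those of the schedulability test. -/
theorem IsMEBAEDFUVD.false_of_busy [Fintype ι] {β x : ℝ} (H : σ.IsMEBAEDFUVD S β x)
    (P : TestPassed τ β x) {t₀ a d s : ℝ} {e : ι → ℝ} (hta : t₀ ≤ a) (had : a ≤ d)
    (he0 : ∀ i, 0 ≤ e i) (heC : ∀ i, e i ≤ τ.C i)
    (he : ∑ i with τ.crit i = Criticality.HC, e i / τ.T i ≤ β * τ.UH)
    (hrun : ∀ w ∈ Ioo t₀ d, w ≠ s → ∃ j, σ.run w = some j ∧ t₀ ≤ S.release j)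
    (hle : ∀ j, t₀ ≤ S.release j → ∃ y, y ≤ S.lcDemand x (a + x * (d - a)) j ∧
      (S.IsHC j → y ≤ e (S.task j)) ∧ σ.exec S j d ≤ max y (S.hcDemand d j) ∧
      (S.release j < a → σ.exec S j d ≤ y)) {j₀ : J}
    (hj₀ : t₀ ≤ S.release j₀) (hj₀d : S.release j₀ < d)
    (hlt : σ.exec S j₀ d < S.jobBound x a d (τ.earlyWork e) τ.hcWork τ.surplusWork j₀) :
    False := by
  refine H.not_fully_used P.x_nonneg P.x_le_one hta had (MCTaskSystem.earlyWork_nonneg he0)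
    (MCTaskSystem.earlyWork_le_hcWork heC) MCTaskSystem.surplusWork_nonneg
    (P.earlyWork_eq_zero he0 he) (P.lc_rate_le he) P.hc_rate_le hrun (fun j hj => ?_) hj₀ hj₀d hlt
  obtain ⟨y, h1, h2, h3, h4⟩ := hle j hj
  exact S.le_jobBound P.x_nonneg P.x_le_one had (P.earlyWork_eq_zero he0 he) h1 h2 h3 h4

/-! ### The guarantees to HC and LC jobs -/

variable [Fintype ι] {β x : ℝ} (H : σ.IsMEBAEDFUVD S β x)
include H

/-- Every job receives what the HC mode guarantees, in either mode. -/
theorem IsMEBAEDFUVD.hcDemand_le_exec (P : TestPassed τ β x) (j₀ : J) :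
    S.hcDemand (S.deadline j₀) j₀ ≤ σ.exec S j₀ (S.deadline j₀) := by
  by_contra! hmiss
  set d := S.deadline j₀
  have hr₀ : S.release j₀ < d := S.release_lt_deadline j₀
  obtain ⟨p, hpd, hp, hbusy⟩ := exists_last_idleInstant (σ := σ) (S := S) d
  obtain ⟨s, hs, hlc, hhc⟩ := H.exists_modeSwitch hpd hp hbusy
  obtain ⟨t₁, ht₁, hinact, hact⟩ := exists_last_not_active hpd (hp.not_active (S.hcDemand d))
  have hpend₀ := pending_of_exec_lt_hcDemand hr₀.le hmiss
  have hrunhc : ∀ w ∈ Ioo t₁ d, s < w →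
      ∃ j, σ.run w = some j ∧ σ.exec S j w < S.hcDemand d j := by
    intro w hw hsw
    obtain ⟨k, hk, -, hlt⟩ := hact w ⟨hw.1, hw.2.le⟩
    exact H.exists_run_hc (hhc w ⟨hsw, hw.2.le⟩) hk.le hlt
  -- If `s ≤ t₁`, all the relevant work is done in the HC mode, and `a = t₀ = t₁` with `e = 0`
  -- suffices.
  rcases le_or_gt s t₁ with hst | hst
  · have hz : ∑ i with τ.crit i = Criticality.HC, (0 : ι → ℝ) i / τ.T i ≤ β * τ.UH := by
      simpa using P.reserve_nonneg
    have hrel : t₁ ≤ S.release j₀ := le_release_of_not_active hinact ht₁.2 hpend₀ hmiss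
    refine H.false_of_busy P (t₀ := t₁) (a := t₁) (s := s) (e := 0) le_rfl ht₁.2
      (fun _ => le_rfl) (fun i => (τ.C_pos i).le) hz ?_ ?_ hrel hr₀
      (hmiss.trans_le (S.hcDemand_le_jobBound hrel))
    · intro w hw _
      obtain ⟨j, hj, hlt⟩ := hrunhc w hw (hst.trans_lt hw.1)
      exact ⟨j, hj, le_release_of_not_active hinact hw.1.le (H.pending_of_run hj) hlt⟩
    · intro j hj
      refine ⟨0, S.lcDemand_nonneg _ _ _, fun _ => le_rfl, ?_, fun h => absurd h (not_lt.mpr hj)⟩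
      rw [← exec_of_le_release (σ := σ) hj]
      exact exec_le_max_of_run ht₁.2
        (fun w hw => hrunhc w hw (hst.trans_lt hw.1)) j
  · obtain ⟨k, hk, -, hklt⟩ := hact s ⟨hst, hs.2⟩
    have hfin : {j | S.release j < s ∧ σ.exec S j s < S.hcDemand d j}.Finite :=
      (S.finite_release_lt s).subset fun j hj => hj.1
    -- The earliest-released job with HC-mode work left at `s` fixes `a`; its virtual deadline is at
    -- most `v`, so on `(a, s)` it keeps out work of later key.
    obtain ⟨j₁, ⟨hj₁s, hj₁lt⟩, hmin⟩ := Set.exists_min_image _ S.release hfin ⟨k, hk, hklt⟩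
    set a := S.release j₁ with ha
    have hpa : p ≤ a := le_release_of_not_active (hp.not_active (S.hcDemand d)) hs.1
      (pending_of_exec_lt_hcDemand hj₁s.le hj₁lt) hj₁lt
    have had : a ≤ d := hj₁s.le.trans hs.2
    set v := a + x * (d - a) with hv
    obtain ⟨t₀, ht₀, hinact', hact'⟩ :=
      exists_last_not_active hpa (hp.not_active (S.lcDemand x v))
    obtain ⟨e, he0, heC, heS, he⟩ := H.exists_exec_le P.reserve_nonneg hs.1
      (fun w hw => hbusy w ⟨hw.1, hw.2.trans hs.2⟩) hlc
    have hlate : ∀ j, σ.exec S j s < S.hcDemand d j → a ≤ S.release j := by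
      intro j hlt
      rcases lt_or_ge (S.release j) s with h | h
      · exact hmin j ⟨h, hlt⟩
      · exact hj₁s.le.trans h
    have hrunlc : ∀ w ∈ Ioo t₀ s, ∃ j, σ.run w = some j ∧ σ.exec S j w < S.lcDemand x v j := by
      intro w hw
      have hwlc : w ∉ σ.hc := hlc w ⟨ht₀.1.trans hw.1.le, hw.2⟩
      rcases le_or_gt w a with hwa | hwa
      · obtain ⟨k, -, hkp, hlt⟩ := hact' w ⟨hw.1, hwa⟩
        exact H.exists_run_lc P.x_le_one hwlc hkp ((lcKey_le_iff P.x_le_one hkp.2.1).mpr hlt)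
      · have hlt := (exec_mono j₁ hw.2.le).trans_lt hj₁lt
        exact H.exists_run_lc P.x_le_one hwlc (pending_of_exec_lt_hcDemand hwa.le hlt)
          (lcKey_le_of_exec_lt_hcDemand P.x_nonneg hlt le_rfl)
    have hrunhc' : ∀ w ∈ Ioo s d, ∃ j, σ.run w = some j ∧ σ.exec S j w < S.hcDemand d j :=
      fun w hw => hrunhc w ⟨hst.trans hw.1, hw.2⟩ hw.1
    have hrel₀ : a ≤ S.release j₀ := hlate j₀ ((exec_mono j₀ hs.2).trans_lt hmiss)
    refine H.false_of_busy P (t₀ := t₀) (a := a) (s := s) ht₀.2 had he0 heC he ?_ ?_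
      (ht₀.2.trans hrel₀) hr₀ (hmiss.trans_le (S.hcDemand_le_jobBound hrel₀))
    · intro w hw hws
      rcases lt_or_gt_of_ne hws with h | h
      · obtain ⟨j, hj, hlt⟩ := hrunlc w ⟨hw.1, h⟩
        exact ⟨j, hj, le_release_of_not_active hinact' hw.1.le (H.pending_of_run hj) hlt⟩
      · obtain ⟨j, hj, hlt⟩ := hrunhc' w ⟨h, hw.2⟩
        exact ⟨j, hj, ht₀.2.trans (hlate j ((exec_mono j h.le).trans_lt hlt))⟩
    · intro j hj
      have hts : t₀ ≤ s := ht₀.2.trans hj₁s.le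
      have hmax := exec_le_max_of_run hs.2 hrunhc' j
      refine ⟨σ.exec S j s, ?_, fun hh => heS j hh (ht₀.1.trans hj), hmax, fun hja => ?_⟩
      · have := exec_le_max_of_run hts hrunlc j
        rwa [exec_of_le_release hj, max_eq_right (S.lcDemand_nonneg _ _ _)] at this
      -- A job released before `a` has its HC-mode demand met at `s`, by minimality of `a`, so it
      -- gains nothing on `(s, d)`.
      · have hge : S.hcDemand d j ≤ σ.exec S j s := by
          by_contra! hlt
          exact absurd (hlate j hlt) (not_le.mpr hja)
        rwa [max_eq_left hge] at hmax

/-- A job of a LC task receives its whole demand in the LC mode. -/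
theorem IsMEBAEDFUVD.demand_le_exec (P : TestPassed τ β x) {j₀ : J} (hl : S.IsLC j₀)
    (hmode : ∀ t ∈ Ico (S.release j₀) (S.deadline j₀), t ∉ σ.hc) :
    S.demand j₀ ≤ σ.exec S j₀ (S.deadline j₀) := by
  by_contra! hmiss
  set d := S.deadline j₀ with hd
  have hr₀ : S.release j₀ < d := S.release_lt_deadline j₀
  obtain ⟨p, hpd, hp, hbusy⟩ := exists_last_idleInstant (σ := σ) (S := S) d
  obtain ⟨s, hs, hlc, hhc⟩ := H.exists_modeSwitch hpd hp hbusy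
  have hpend₀ : σ.Pending S j₀ d := by
    refine ⟨hr₀.le, hmiss, ?_⟩
    rintro ⟨-, u, u', h1, h2, h3, h4, -⟩
    exact hmode u ⟨h1, h2.trans_le h3⟩ (h4 ⟨le_rfl, h2⟩)
  -- A switch before `d` would put HC-mode times into the window of `j₀`.
  have hsd : s = d := by
    by_contra hne
    have hlt : s < d := lt_of_le_of_ne hs.2 hne
    obtain ⟨w, hw1, hw2⟩ := exists_between (max_lt hlt hr₀)
    exact hmode w ⟨((le_max_right _ _).trans_lt hw1).le, hw2⟩
      (hhc w ⟨(le_max_left _ _).trans_lt hw1, hw2.le⟩)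
  rw [hsd] at hlc
  -- With `a = d`, the threshold `a + x * (d - a)` is `d` itself; it is kept unsimplified to match
  -- `false_of_busy`.
  obtain ⟨t₀, ht₀, hinact, hact⟩ :=
    exists_last_not_active hpd (hp.not_active (S.lcDemand x (d + x * (d - d))))
  obtain ⟨e, he0, heC, heS, he⟩ := H.exists_exec_le P.reserve_nonneg hpd hbusy hlc
  have hrun : ∀ w ∈ Ioo t₀ d, ∃ j, σ.run w = some j ∧
      σ.exec S j w < S.lcDemand x (d + x * (d - d)) j := by
    intro w hw
    obtain ⟨k, -, hkp, hlt⟩ := hact w ⟨hw.1, hw.2.le⟩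
    exact H.exists_run_lc P.x_le_one (hlc w ⟨ht₀.1.trans hw.1.le, hw.2⟩) hkp
      ((lcKey_le_iff P.x_le_one hkp.2.1).mpr hlt)
  have hdv : S.deadline j₀ ≤ d + x * (d - d) := by rw [← hd]; simp
  have hrel₀ : t₀ ≤ S.release j₀ := by
    refine le_release_of_not_active hinact ht₀.2 hpend₀ ?_
    simpa only [JobSequence.lcDemand, hl, hdv, if_true] using hmiss
  refine H.false_of_busy P (t₀ := t₀) (a := d) (s := d) ht₀.2 le_rfl he0 heC he ?_ ?_ hrel₀ hr₀
    (hmiss.trans_le (S.demand_le_jobBound P.x_le_one hl hr₀ hdv))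
  · intro w hw _
    obtain ⟨j, hj, hlt⟩ := hrun w hw
    exact ⟨j, hj, le_release_of_not_active hinact hw.1.le (H.pending_of_run hj) hlt⟩
  · intro j hj
    refine ⟨σ.exec S j d, ?_, fun hh => heS j hh (ht₀.1.trans hj), le_max_left _ _,
      fun _ => le_rfl⟩
    have := exec_le_max_of_run ht₀.2 hrun j
    rwa [exec_of_le_release hj, max_eq_right (S.lcDemand_nonneg _ _ _)] at this

end Schedule

end

theorem theorem1 {ι : Type*} [Fintype ι] (τ : MCTaskSystem ι) (β x : ℝ)
    (hβ : β ∈ Set.Icc (0 : ℝ) 1) (hx : x ∈ Set.Icc (0 : ℝ) 1)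
    (hUH : 0 < τ.UH) (hUL : 0 < τ.UL)
    (hα : τ.alphaStar < 1) (hden : τ.UL * (1 - τ.alphaStar) < 1)
    (htest : (τ.UH + τ.UL - 1) / (τ.UL * τ.UH) ≤ (1 - τ.alphaStar) * (1 - β))
    (hrange : x ∈ Set.Icc
      ((β * τ.UH + τ.alphaStar * τ.UL) / (1 - τ.UL * (1 - τ.alphaStar)))
      ((1 - τ.UH - τ.alphaStar * τ.UL) / ((1 - τ.alphaStar) * τ.UL))) :
    MCSchedulable τ β x := by
  have P : Schedule.TestPassed τ β x := by
    have h1 := (div_le_iff₀ (sub_pos.mpr hden)).mp hrange.1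
    have h2 := (le_div_iff₀ (mul_pos (sub_pos.mpr hα) hUL)).mp hrange.2
    exact
      { x_nonneg := hx.1
        x_le_one := hx.2
        UL_pos := hUL
        reserve_nonneg := mul_nonneg hβ.1 hUH.le
        slack_nonneg := by linarith
        lc := by linarith
        hc := by linarith }
  intro J S σ H j
  -- At the job's own deadline, `hcDemand` is the full demand of a HC job and the minimum of demand
  -- and budget of a LC job.
  have hj := H.hcDemand_le_exec P j
  refine ⟨fun hh => ?_, fun hl hmode => H.demand_le_exec P hl hmode, fun hl _ => ?_⟩
  · have hl := (S.isHC_iff_not_isLC j).mp hh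
    simpa [JobSequence.hcDemand, hl] using hj
  · simpa [JobSequence.hcDemand, hl, min_comm] using hj
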